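/- For an integer $k\ge 1$ let $G_k$ be the following connected simple undirected graph on $3k+5$ vertices. There are five vertices $0,1,2,3,4$ and three groups of $k$ vertices each, the vertices of the groups being labeled $5$, $6$ and $7$, respectively. The edges are: $1\,\text{—}\,2$, $2\,\text{—}\,3$, $0\,\text{—}\,3$, $3\,\text{—}\,4$; an edge between $0$ and every vertex labeled $5$ (a star with $k$ leaves around $0$); an edge between $4$ and every vertex labeled $7$ (a star with $k$ leaves around $4$); and all edges among the vertices $1$, $2$ and the $k$ vertices labeled $6$ (a $(k+2)$-clique). For a graph $G$ on $n$ vertices without isolated vertices let $\bar G$ be its row-normalized adjacency matrix; PageRank with damping factor $\alpha$ (and uniform preference vector) is the row vector $c_G=(1-\alpha)\,\tfrac1n\mathbf 1\,(1-\alpha\bar G)^{-1}$. For non-adjacent vertices $x\ne y$ of $G$ let $G'$ be $G$ with the edge $x\,\text{—}\,y$ added. A centrality $c$ is *score monotone* on $G$ if for all non-adjacent $x\neq y$ we have $c_G(x)<c_{G'}(x)$ and $c_G(y)<c_{G'}(y)$. It is *rank monotone* on $G$ if for all non-adjacent $x\ne y$, all vertices $z\ne x,y$ and each endpoint $w\in\{x,y\}$,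 $c_G(z)<c_G(w)$ implies $c_{G'}(z)<c_{G'}(w)$, and $c_G(z)\le c_G(w)$ implies $c_{G'}(z)\le c_{G'}(w)$. **Theorem.** For every $\alpha\in(0,1)$ there is a $K$ such that for all $k\ge K$ PageRank $c$ with damping factor $\alpha$ is neither score monotone nor rank monotone on $G_k$. More precisely, both violations occur when the edge $0\,\text{—}\,1$ is added to $G=G_k$, giving $G'$, they hurt vertex $0$, and they are top violations (the hurt endpoint is the more important one): $c_{G}(1)<c_{G}(0)$; $c_{G'}(0)<c_{G}(0)$; and there is a vertex $z\neq 0,1$ such that either $c_{G}(z)<c_{G}(0)$ and $c_{G'}(z)\ge c_{G'}(0)$, or $c_{G}(z)\le c_{G}(0)$ and $c_{G'}(z)>c_{G'}(0)$. -/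

import Mathlib

namespace CentralityMonotonicity

/-! ### Centralities and monotonicity under edge addition -/

section Monotonicity

variable {V : Type*}

/-- The graph obtained from `G` by adding the edge between `x` and `y`. -/
def addEdge (G : SimpleGraph V) (x y : V) : SimpleGraph V := G ⊔ SimpleGraph.edge x y

/-- `c` is score monotone on `G`: adding an edge between two non-adjacent vertices strictly
increases the score of both of them. -/
def IsScoreMonotoneOn (c : SimpleGraph V → V → ℝ) (G : SimpleGraph V) : Prop :=
  ∀ x y : V, x ≠ y → ¬ G.Adj x y →
    c G x < c (addEdge G x y) x ∧ c G y < c (addEdge G x y) y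

/-- `c` is rank monotone on `G`: when an edge between two non-adjacent vertices is added, every
other vertex that was (strictly) dominated by an endpoint is still (strictly) dominated by it. -/
def IsRankMonotoneOn (c : SimpleGraph V → V → ℝ) (G : SimpleGraph V) : Prop :=
  ∀ x y : V, x ≠ y → ¬ G.Adj x y → ∀ z : V, z ≠ x → z ≠ y →
    ((c G z < c G x → c (addEdge G x y) z < c (addEdge G x y) x) ∧
      (c G z < c G y → c (addEdge G x y) z < c (addEdge G x y) y)) ∧
    ((c G z ≤ c G x → c (addEdge G x y) z ≤ c (addEdge G x y) x) ∧
      (c G z ≤ c G y → c (addEdge G x y) z ≤ c (addEdge G x y) y))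

/-- Adding the edge between the non-adjacent vertices `x` and `y` of `G` is a top violation of
score monotonicity in which `x` is hurt: `x` is more important than `y` in `G`, and its score
decreases. -/
def IsTopScoreViolation (c : SimpleGraph V → V → ℝ) (G : SimpleGraph V) (x y : V) : Prop :=
  x ≠ y ∧ ¬ G.Adj x y ∧ c G y < c G x ∧ c (addEdge G x y) x < c G x

/-- Adding the edge between the non-adjacent vertices `x` and `y` of `G` is a top violation of
rank monotonicity in which `x` is hurt: `x` is more important than `y` in `G`, and some other
vertex `z` that was (strictly) dominated by `x` is no longer (strictly) dominated by `x`. -/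
def IsTopRankViolation (c : SimpleGraph V → V → ℝ) (G : SimpleGraph V) (x y : V) : Prop :=
  x ≠ y ∧ ¬ G.Adj x y ∧ c G y < c G x ∧
    ∃ z : V, z ≠ x ∧ z ≠ y ∧
      ((c G z < c G x ∧ c (addEdge G x y) x ≤ c (addEdge G x y) z) ∨
        (c G z ≤ c G x ∧ c (addEdge G x y) x < c (addEdge G x y) z))

end Monotonicity

/-! ### PageRank -/

section PageRank

variable {V : Type*} [Fintype V]

open Classical in
/-- The row-normalized adjacency matrix of `G`; null rows are left untouched. -/
noncomputable def normalizedAdj (G : SimpleGraph V) : Matrix V V ℝ :=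
  Matrix.of fun x y => G.adjMatrix ℝ x y / ∑ z, G.adjMatrix ℝ x z

open Classical in
/-- PageRank `(1 - α) v (1 - α Ḡ)⁻¹` with damping factor `α` and uniform preference (row) vector
`v`, for graphs without isolated vertices. -/
noncomputable def pageRank (α : ℝ) (G : SimpleGraph V) : V → ℝ :=
  (1 - α) • Matrix.vecMul (fun _ : V => (1 : ℝ) / Fintype.card V) (1 - α • normalizedAdj G)⁻¹

end PageRank

/-! ### The graphs `G_k` -/

/-- The vertices of `G_k`: five vertices with labels `0, 1, 2, 3, 4`, and three groups of `k`
vertices each. -/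
abbrev Vertex (k : ℕ) : Type := Fin 5 ⊕ (Fin 3 × Fin k)

/-- The label of a vertex: the vertices in the three groups have label `5`, `6` and `7`. -/
def label {k : ℕ} : Vertex k → ℕ
  | Sum.inl i => i.val
  | Sum.inr (g, _) => 5 + g.val

/-- The pairs of labels joined by edges: the connecting part `1 - 2 - 3`, `0 - 3`, `3 - 4`; the
star of vertices labeled `5` around `0`; the star of vertices labeled `7` around `4`; and the
clique formed by `1`, `2` and the vertices labeled `6`. -/
def labelEdges : Set (Sym2 ℕ) :=
  {s(1, 2), s(2, 3), s(0, 3), s(3, 4), s(0, 5), s(4, 7), s(1, 6), s(2, 6), s(6, 6)}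

/-- The graph `G_k`: two distinct vertices are adjacent iff their labels are joined. -/
def starCliqueGraph (k : ℕ) : SimpleGraph (Vertex k) where
  Adj u v := u ≠ v ∧ s(label u, label v) ∈ labelEdges
  symm := ⟨fun u v h => ⟨h.1.symm, by rw [Sym2.eq_swap]; exact h.2⟩⟩
  loopless := ⟨fun _ h => h.1 rfl⟩

end CentralityMonotonicity

/-!
Let `r` be PageRank without its scalar factor `(1 - α) / n`, and let the *flow* of a vertex be
`t v = r v / d v`, where `d v` is the degree: it is what `v` passes on to each neighbor. The
equation of PageRank reads `d v * t v = 1 + α * ∑ t u`, the sum being over the neighbors `u` of `v`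
(`degree_mul_flow`), so a maximum principle yields `0 ≤ t v ≤ M` with `M = 1 / (1 - α)`
(`flow_nonneg`, `flow_le`).

In `G_k` the clique keeps little: summing the equation over the vertices labeled `6` shows that
their flows add up to at most `3 * M ^ 2`, so `r 1` and `r 2` are at most `6 * M ^ 2`, while
`r 0 ≥ 1 + α * k` because of the star. Eliminating the leaves of the two stars gives
* `(k + 1 - α ^ 2 * k) * t 0 = 1 + α * k + α * t 3` in `G_k`, and the same equation for `t 4`;
* `(k + 2 - α ^ 2 * k) * t 0 = 1 + α * k + α * t 3 + α * t 1` in `G'`, where the equation for `t 4`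
  is the old one.

Hence `0` and `4` have the same score in `G_k`. Adding the edge dilutes the flow from `0` to its
leaves: of the score that came back to `0` from there, a part that is bounded away from zero
as `k` grows is lost. What `0` gains is `α * t 1 = O(1 / k)` from its new neighbor, and `α` times
the change of `t 3`, which is `O(1 / k)` as well. For large `k` the loss prevails: `0` falls below
its former score (`score_decrease`) and below `4` (`rank_drop`).
-/

namespace CentralityMonotonicity

/-! ### Violations refute monotonicity -/

section Violations

variable {V : Type*} {c : SimpleGraph V → V → ℝ} {G : SimpleGraph V} {x y : V}

theorem IsTopScoreViolation.not_isScoreMonotoneOn (h : IsTopScoreViolation c G x y) :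
    ¬ IsScoreMonotoneOn c G := fun hm =>
  lt_asymm h.2.2.2 (hm x y h.1 h.2.1).1

theorem IsTopRankViolation.not_isRankMonotoneOn (h : IsTopRankViolation c G x y) :
    ¬ IsRankMonotoneOn c G := by
  intro hm
  obtain ⟨hxy, hadj, -, z, hzx, hzy, hz⟩ := h
  obtain ⟨⟨hlt, -⟩, hle, -⟩ := hm x y hxy hadj z hzx hzy
  rcases hz with ⟨h1, h2⟩ | ⟨h1, h2⟩
  · exact absurd (hlt h1) h2.not_gt
  · exact absurd (hle h1) h2.not_ge

end Violations

/-! ### PageRank and the flow along edges -/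

section Flow

variable {V : Type*} [Fintype V]

open Classical in
/-- The sum of `f` over the neighbors of `v`. -/
noncomputable def nbrSum (G : SimpleGraph V) (f : V → ℝ) (v : V) : ℝ :=
  ∑ u, if G.Adj v u then f u else 0

/-- The degree of a vertex, as a real number. -/
noncomputable def realDegree (G : SimpleGraph V) (v : V) : ℝ := nbrSum G (fun _ => 1) v

theorem nbrSum_mono (G : SimpleGraph V) {f g : V → ℝ} (h : ∀ u, f u ≤ g u) (v : V) :
    nbrSum G f v ≤ nbrSum G g v := by
  classical
  unfold nbrSum
  refine Finset.sum_le_sum fun u _ => ?_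
  split_ifs
  · exact h u
  · exact le_rfl

theorem nbrSum_const (G : SimpleGraph V) (a : ℝ) (v : V) :
    nbrSum G (fun _ => a) v = realDegree G v * a := by
  classical
  simp only [realDegree, nbrSum, Finset.sum_mul, ite_mul, one_mul, zero_mul]

theorem nbrSum_const_mul (G : SimpleGraph V) (a : ℝ) (f : V → ℝ) (v : V) :
    nbrSum G (fun u => a * f u) v = a * nbrSum G f v := by
  classical
  simp [nbrSum, Finset.mul_sum]

open Classical in
theorem nbrSum_addEdge {G : SimpleGraph V} {x y : V} (hxy : x ≠ y) (hadj : ¬ G.Adj x y)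
    (f : V → ℝ) (v : V) :
    nbrSum (addEdge G x y) f v =
      nbrSum G f v + ((if v = x then f y else 0) + (if v = y then f x else 0)) := by
  have h : ∀ u, (if (addEdge G x y).Adj v u then f u else 0) =
      (if G.Adj v u then f u else 0) +
        ((if u = y then (if v = x then f u else 0) else 0) +
          (if u = x then (if v = y then f u else 0) else 0)) := by
    intro u
    have hadj' : ¬ G.Adj y x := fun h => hadj h.symm
    simp only [addEdge, SimpleGraph.sup_adj, SimpleGraph.edge_adj]
    by_cases h1 : u = y <;> by_cases h2 : u = x <;> by_cases h3 : v = x <;> by_cases h4 : v = y <;>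
      simp_all
  unfold nbrSum
  rw [Finset.sum_congr rfl fun u _ => h u, Finset.sum_add_distrib, Finset.sum_add_distrib]
  simp

theorem normalizedAdj_apply (G : SimpleGraph V) (x y : V) [Decidable (G.Adj x y)] :
    normalizedAdj G x y = (if G.Adj x y then 1 else 0) / realDegree G x := by
  classical
  simp only [normalizedAdj, realDegree, nbrSum, SimpleGraph.adjMatrix_apply, Matrix.of_apply]
  congr!

/-- For a damping factor in `[0, 1)` the matrix `1 - α Ḡ` is strictly diagonally dominant. -/
theorem isUnit_det_one_sub_smul_normalizedAdj [DecidableEq V] (G : SimpleGraph V) {α : ℝ}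
    (h0 : 0 ≤ α) (h1 : α < 1) (hd : ∀ v, 0 < realDegree G v) :
    IsUnit (1 - α • normalizedAdj G).det := by
  classical
  rw [isUnit_iff_ne_zero]
  refine det_ne_zero_of_sum_row_lt_diag fun v => ?_
  have hdiag : (1 - α • normalizedAdj G) v v = 1 := by
    simp [normalizedAdj_apply]
  have hoff : ∀ u ∈ Finset.univ.erase v, ‖(1 - α • normalizedAdj G) v u‖ =
      α / realDegree G v * (if G.Adj v u then 1 else 0) := by
    intro u hu
    have hvu : v ≠ u := (Finset.ne_of_mem_erase hu).symm
    have := (hd v).le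
    rw [Matrix.sub_apply, Matrix.one_apply_ne hvu, Matrix.smul_apply, normalizedAdj_apply,
      zero_sub, norm_neg, Real.norm_of_nonneg]
    · simp only [smul_eq_mul]; ring
    · simp only [smul_eq_mul]; split_ifs <;> positivity
  rw [hdiag, Finset.sum_congr rfl hoff, ← Finset.mul_sum, Finset.sum_erase _ (by simp)]
  have hs : (∑ u, if G.Adj v u then (1 : ℝ) else 0) = realDegree G v := rfl
  rw [hs, div_mul_cancel₀ _ (hd v).ne']
  simpa using h1

/-- The amount that `v` passes on to each of its neighbors: its PageRank, freed from the factor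
`(1 - α) / n`, divided by its degree. -/
noncomputable def flow (α : ℝ) (G : SimpleGraph V) (v : V) : ℝ :=
  Fintype.card V / (1 - α) * pageRank α G v / realDegree G v

theorem pageRank_eq_flow [Nonempty V] (G : SimpleGraph V) {α : ℝ} (h1 : α < 1)
    (hd : ∀ v, 0 < realDegree G v) (v : V) :
    pageRank α G v = (1 - α) / Fintype.card V * (realDegree G v * flow α G v) := by
  have := (hd v).ne'
  have hn : (Fintype.card V : ℝ) ≠ 0 := by simp
  have : 1 - α ≠ 0 := by linarith
  unfold flow
  field_simp

theorem pageRank_lt_iff [Nonempty V] {G H : SimpleGraph V} {α : ℝ} (h1 : α < 1)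
    (hG : ∀ v, 0 < realDegree G v) (hH : ∀ v, 0 < realDegree H v) (v w : V) :
    pageRank α G v < pageRank α H w ↔
      realDegree G v * flow α G v < realDegree H w * flow α H w := by
  have hn : (0 : ℝ) < Fintype.card V := by simp [Fintype.card_pos]
  rw [pageRank_eq_flow G h1 hG, pageRank_eq_flow H h1 hH]
  exact mul_lt_mul_iff_right₀ (div_pos (by linarith) hn)

/-- The PageRank equation, in terms of the flow. -/
theorem degree_mul_flow [Nonempty V] (G : SimpleGraph V) {α : ℝ} (h0 : 0 ≤ α) (h1 : α < 1)
    (hd : ∀ v, 0 < realDegree G v) (v : V) :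
    realDegree G v * flow α G v = 1 + α * nbrSum G (flow α G) v := by
  classical
  have hn : (Fintype.card V : ℝ) ≠ 0 := by simp
  have hα : 1 - α ≠ 0 := by linarith
  have hU := isUnit_det_one_sub_smul_normalizedAdj G h0 h1 hd
  have hM : Matrix.vecMul (pageRank α G) (1 - α • normalizedAdj G) v =
      (1 - α) * (1 / Fintype.card V) := by
    have : pageRank α G = (1 - α) • Matrix.vecMul (fun _ : V => (1 : ℝ) / Fintype.card V)
        (1 - α • normalizedAdj G)⁻¹ := by
      unfold pageRank
      congr!
    rw [this, Matrix.smul_vecMul, Matrix.vecMul_vecMul, Matrix.nonsing_inv_mul _ hU,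
      Matrix.vecMul_one]
    simp
  have hsum : Matrix.vecMul (pageRank α G) (normalizedAdj G) v =
      (1 - α) / Fintype.card V * nbrSum G (flow α G) v := by
    rw [← nbrSum_const_mul]
    simp only [Matrix.vecMul, dotProduct, nbrSum]
    refine Finset.sum_congr rfl fun u _ => ?_
    rw [normalizedAdj_apply, pageRank_eq_flow G h1 hd]
    have := (hd u).ne'
    by_cases h : G.Adj u v
    · simp only [h, h.symm, if_true]; field_simp
    · have h' : ¬ G.Adj v u := fun h' => h h'.symm
      simp [h, h']
  rw [Matrix.vecMul_sub, Matrix.vecMul_one, Matrix.vecMul_smul, Pi.sub_apply, Pi.smul_apply, hsum,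
    pageRank_eq_flow G h1 hd, smul_eq_mul] at hM
  field_simp at hM
  linarith

/-- The minimum principle for the flow. -/
theorem flow_nonneg [Nonempty V] (G : SimpleGraph V) {α : ℝ} (h0 : 0 ≤ α) (h1 : α < 1)
    (hd : ∀ v, 0 < realDegree G v) (v : V) : 0 ≤ flow α G v := by
  obtain ⟨w, hw⟩ := Finite.exists_min (flow α G)
  refine le_trans ?_ (hw v)
  have h := nbrSum_mono G hw w
  rw [nbrSum_const] at h
  have he := degree_mul_flow G h0 h1 hd w
  have : 0 ≤ (1 - α) * realDegree G w * flow α G w := by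
    nlinarith [mul_le_mul_of_nonneg_left h h0]
  exact nonneg_of_mul_nonneg_right this (mul_pos (by linarith) (hd w))

/-- The maximum principle for the flow. -/
theorem flow_le [Nonempty V] (G : SimpleGraph V) {α : ℝ} (h0 : 0 ≤ α) (h1 : α < 1)
    (hd : ∀ v, 1 ≤ realDegree G v) (v : V) : flow α G v ≤ 1 / (1 - α) := by
  have hd' : ∀ v, 0 < realDegree G v := fun v => one_pos.trans_le (hd v)
  obtain ⟨w, hw⟩ := Finite.exists_max (flow α G)
  refine (hw v).trans ?_
  have h := nbrSum_mono G hw w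
  rw [nbrSum_const] at h
  have he := degree_mul_flow G h0 h1 hd' w
  rw [le_div_iff₀ (by linarith)]
  have hn : 0 ≤ flow α G w * (1 - α) :=
    mul_nonneg (flow_nonneg G h0 h1 hd' w) (by linarith)
  nlinarith [mul_le_mul_of_nonneg_left h h0, mul_le_mul_of_nonneg_right (hd w) hn]

end Flow

/-! ### Neighborhoods in `G_k` -/

section StarClique

variable {k : ℕ} (f : Vertex k → ℝ)

/-- The sum of `f` over the `g`-th group of vertices, that is, those labeled `5 + g`. -/
noncomputable def groupSum (g : Fin 3) : ℝ := ∑ i, f (Sum.inr (g, i))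

theorem starCliqueGraph_not_adj : ¬ (starCliqueGraph k).Adj (Sum.inl 0) (Sum.inl 1) := by
  simp [starCliqueGraph, labelEdges, label]

theorem nbrSum_starCliqueGraph_zero : nbrSum (starCliqueGraph k) f (Sum.inl 0) =
    f (Sum.inl 3) + groupSum f 0 := by
  simp [nbrSum, groupSum, starCliqueGraph, labelEdges, label, Fin.sum_univ_five,
    Fintype.sum_prod_type, Fin.sum_univ_three]

theorem nbrSum_starCliqueGraph_one : nbrSum (starCliqueGraph k) f (Sum.inl 1) =
    f (Sum.inl 2) + groupSum f 1 := by
  simp [nbrSum, groupSum, starCliqueGraph, labelEdges, label, Fin.sum_univ_five,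
    Fintype.sum_prod_type, Fin.sum_univ_three]

theorem nbrSum_starCliqueGraph_two : nbrSum (starCliqueGraph k) f (Sum.inl 2) =
    f (Sum.inl 1) + f (Sum.inl 3) + groupSum f 1 := by
  simp [nbrSum, groupSum, starCliqueGraph, labelEdges, label, Fin.sum_univ_five,
    Fintype.sum_prod_type, Fin.sum_univ_three]

theorem nbrSum_starCliqueGraph_three : nbrSum (starCliqueGraph k) f (Sum.inl 3) =
    f (Sum.inl 0) + f (Sum.inl 2) + f (Sum.inl 4) := by
  simp [nbrSum, starCliqueGraph, labelEdges, label, Fin.sum_univ_five,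
    Fintype.sum_prod_type, Fin.sum_univ_three]

theorem nbrSum_starCliqueGraph_four : nbrSum (starCliqueGraph k) f (Sum.inl 4) =
    f (Sum.inl 3) + groupSum f 2 := by
  simp [nbrSum, groupSum, starCliqueGraph, labelEdges, label, Fin.sum_univ_five,
    Fintype.sum_prod_type, Fin.sum_univ_three]

theorem nbrSum_starCliqueGraph_five (i : Fin k) :
    nbrSum (starCliqueGraph k) f (Sum.inr (0, i)) = f (Sum.inl 0) := by
  simp [nbrSum, starCliqueGraph, labelEdges, label]

theorem nbrSum_starCliqueGraph_six (i : Fin k) :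
    nbrSum (starCliqueGraph k) f (Sum.inr (1, i)) =
      f (Sum.inl 1) + f (Sum.inl 2) + (groupSum f 1 - f (Sum.inr (1, i))) := by
  have h : (∑ j, if i = j then 0 else f (Sum.inr (1, j))) =
      groupSum f 1 - f (Sum.inr (1, i)) := by
    rw [groupSum, eq_sub_iff_add_eq, ← Finset.sum_erase_add _ _ (Finset.mem_univ i)]
    simp [Finset.sum_ite, Finset.filter_ne]
  simp [nbrSum, starCliqueGraph, labelEdges, label, Fin.sum_univ_five,
    Fintype.sum_prod_type, Fin.sum_univ_three, h]

theorem nbrSum_starCliqueGraph_seven (i : Fin k) :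
    nbrSum (starCliqueGraph k) f (Sum.inr (2, i)) = f (Sum.inl 4) := by
  simp [nbrSum, starCliqueGraph, labelEdges, label, Fin.sum_univ_five,
    Fintype.sum_prod_type, Fin.sum_univ_three]

variable {α : ℝ} {G : SimpleGraph (Vertex k)}

/-- The leaves of a star with center `c` receive their score from `c` alone. -/
theorem groupSum_flow_of_leaves (h0 : 0 ≤ α) (h1 : α < 1) (hd : ∀ v, 0 < realDegree G v)
    (g : Fin 3) (c : Vertex k) (h : ∀ f i, nbrSum G f (Sum.inr (g, i)) = f c) :
    groupSum (flow α G) g = k * (1 + α * flow α G c) := by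
  have hi : ∀ i, flow α G (Sum.inr (g, i)) = 1 + α * flow α G c := by
    intro i
    have he := degree_mul_flow G h0 h1 hd (Sum.inr (g, i))
    rwa [realDegree, h, h, one_mul] at he
  simp only [groupSum, hi, Finset.sum_const, Finset.card_univ, Fintype.card_fin, nsmul_eq_mul]

/-- The flows of the vertices labeled `6` have a bounded sum. -/
theorem groupSum_flow_clique_le (h0 : 0 ≤ α) (h1 : α < 1) (hd : ∀ v, 1 ≤ realDegree G v)
    (h : ∀ f i, nbrSum G f (Sum.inr (1, i)) =
      f (Sum.inl 1) + f (Sum.inl 2) + (groupSum f 1 - f (Sum.inr (1, i)))) :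
    groupSum (flow α G) 1 ≤ 3 * (1 / (1 - α)) ^ 2 := by
  have hd' : ∀ v, 0 < realDegree G v := fun v => one_pos.trans_le (hd v)
  have hflow := flow_le G h0 h1 hd
  have hM1 : 1 ≤ 1 / (1 - α) := by
    rw [le_div_iff₀ (by linarith)]; linarith
  have hM : 1 / (1 - α) * (1 - α) = 1 := div_mul_cancel₀ _ (by linarith)
  set M := 1 / (1 - α)
  rcases Nat.eq_zero_or_pos k with rfl | hk
  · simp only [groupSum, Finset.univ_eq_empty, Finset.sum_empty]; positivity
  have hk' : (0 : ℝ) < k := by exact_mod_cast hk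
  set t := flow α G
  set S := groupSum t 1
  have hS0 : 0 ≤ S := Finset.sum_nonneg fun i _ => flow_nonneg G h0 h1 hd' _
  have hi : ∀ i, (k + 1 + α) * t (Sum.inr (1, i)) =
      1 + α * (t (Sum.inl 1) + t (Sum.inl 2) + S) := by
    intro i
    have he := degree_mul_flow G h0 h1 hd' (Sum.inr (1, i))
    rw [realDegree, h, h] at he
    simp only [groupSum, Finset.sum_const, Finset.card_univ, Fintype.card_fin, nsmul_eq_mul] at he
    simp only [S, groupSum]
    linear_combination he
  have hsum : (k + 1 + α) * S = k * (1 + α * (t (Sum.inl 1) + t (Sum.inl 2) + S)) := by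
    simp only [S, groupSum] at hi ⊢
    rw [Finset.mul_sum, Finset.sum_congr rfl fun i _ => hi i, Finset.sum_const, Finset.card_univ,
      Fintype.card_fin, nsmul_eq_mul]
  have hα12 : α * (t (Sum.inl 1) + t (Sum.inl 2)) ≤ 2 * M := by
    nlinarith [hflow (Sum.inl 1), hflow (Sum.inl 2),
      flow_nonneg G h0 h1 hd' (Sum.inl 1), flow_nonneg G h0 h1 hd' (Sum.inl 2)]
  have hS : k * ((1 - α) * S) ≤ k * (1 + 2 * M) := by
    nlinarith [mul_le_mul_of_nonneg_left hα12 hk'.le, mul_nonneg h0 hS0]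
  have hS' : (1 - α) * S ≤ 1 + 2 * M := le_of_mul_le_mul_left hS hk'
  calc S = M * ((1 - α) * S) := by rw [← mul_assoc, hM, one_mul]
    _ ≤ M * (1 + 2 * M) := by gcongr
    _ ≤ 3 * M ^ 2 := by nlinarith

end StarClique

/-! ### The equations for the flow in `G_k` and in `G'` -/

/-- The graph obtained from `G_k` by joining `0` and `1`. -/
abbrev joinedGraph (k : ℕ) : SimpleGraph (Vertex k) :=
  addEdge (starCliqueGraph k) (Sum.inl 0) (Sum.inl 1)

section Equations

variable {k : ℕ} {α : ℝ}

theorem nbrSum_joinedGraph (f : Vertex k → ℝ) (v : Vertex k) :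
    nbrSum (joinedGraph k) f v = nbrSum (starCliqueGraph k) f v +
      ((if v = Sum.inl 0 then f (Sum.inl 1) else 0) +
        (if v = Sum.inl 1 then f (Sum.inl 0) else 0)) := by
  classical
  rw [nbrSum_addEdge (by simp) starCliqueGraph_not_adj]
  congr!

theorem one_le_realDegree_starCliqueGraph (v : Vertex k) :
    1 ≤ realDegree (starCliqueGraph k) v := by
  have hk : (0 : ℝ) ≤ k := k.cast_nonneg
  rcases v with i | ⟨g, i⟩
  · fin_cases i <;> simp only [realDegree, Fin.zero_eta, Fin.mk_one, Fin.reduceFinMk,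
      nbrSum_starCliqueGraph_zero, nbrSum_starCliqueGraph_one, nbrSum_starCliqueGraph_two,
      nbrSum_starCliqueGraph_three, nbrSum_starCliqueGraph_four, groupSum, Finset.sum_const,
      Finset.card_univ, Fintype.card_fin, nsmul_eq_mul, mul_one] <;> linarith
  · fin_cases g <;> simp only [realDegree, Fin.zero_eta, Fin.mk_one, Fin.reduceFinMk,
      nbrSum_starCliqueGraph_five, nbrSum_starCliqueGraph_six, nbrSum_starCliqueGraph_seven,
      groupSum, Finset.sum_const, Finset.card_univ, Fintype.card_fin, nsmul_eq_mul, mul_one] <;>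
      linarith

theorem one_le_realDegree_joinedGraph (v : Vertex k) : 1 ≤ realDegree (joinedGraph k) v := by
  rw [realDegree, nbrSum_joinedGraph]
  refine (one_le_realDegree_starCliqueGraph v).trans (le_add_of_nonneg_right ?_)
  split_ifs <;> norm_num

theorem realDegree_starCliqueGraph_zero :
    realDegree (starCliqueGraph k) (Sum.inl 0) = k + 1 := by
  simp [realDegree, nbrSum_starCliqueGraph_zero, groupSum, add_comm]

theorem realDegree_starCliqueGraph_one :
    realDegree (starCliqueGraph k) (Sum.inl 1) = k + 1 := by
  simp [realDegree, nbrSum_starCliqueGraph_one, groupSum, add_comm]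

theorem realDegree_starCliqueGraph_two :
    realDegree (starCliqueGraph k) (Sum.inl 2) = k + 2 := by
  simp only [realDegree, nbrSum_starCliqueGraph_two, groupSum, Finset.sum_const,
    Finset.card_univ, Fintype.card_fin, nsmul_eq_mul, mul_one]
  ring

theorem realDegree_starCliqueGraph_three :
    realDegree (starCliqueGraph k) (Sum.inl 3) = 3 := by
  simp only [realDegree, nbrSum_starCliqueGraph_three]
  norm_num

theorem realDegree_starCliqueGraph_four :
    realDegree (starCliqueGraph k) (Sum.inl 4) = k + 1 := by
  simp [realDegree, nbrSum_starCliqueGraph_four, groupSum, add_comm]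

theorem realDegree_joinedGraph (v : Vertex k) :
    realDegree (joinedGraph k) v = realDegree (starCliqueGraph k) v +
      ((if v = Sum.inl 0 then 1 else 0) + (if v = Sum.inl 1 then 1 else 0)) :=
  nbrSum_joinedGraph _ v

/-- The facts about the flow in `G_k` on which the comparison with `G'` rests; `x i` is the flow of
vertex `i`. -/
theorem flow_starCliqueGraph (h0 : 0 ≤ α) (h1 : α < 1) (x : Fin 5 → ℝ)
    (hx : ∀ i, x i = flow α (starCliqueGraph k) (Sum.inl i)) :
    (k + 1) * x 0 = 1 + α * (x 3 + k * (1 + α * x 0)) ∧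
    (k + 1) * x 1 ≤ 6 * (1 / (1 - α)) ^ 2 ∧
    3 * x 3 = 1 + α * (x 0 + x 2 + x 4) ∧
    (k + 1) * x 4 = 1 + α * (x 3 + k * (1 + α * x 4)) := by
  have hd1 := one_le_realDegree_starCliqueGraph (k := k)
  have hd : ∀ v, 0 < realDegree (starCliqueGraph k) v := fun v => one_pos.trans_le (hd1 v)
  have he := degree_mul_flow (starCliqueGraph k) h0 h1 hd
  have h5 := groupSum_flow_of_leaves h0 h1 hd 0 (Sum.inl 0) nbrSum_starCliqueGraph_five
  have h7 := groupSum_flow_of_leaves h0 h1 hd 2 (Sum.inl 4) nbrSum_starCliqueGraph_seven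
  have h6 := groupSum_flow_clique_le h0 h1 hd1 nbrSum_starCliqueGraph_six
  have e0 := he (Sum.inl 0)
  have e1 := he (Sum.inl 1)
  have e3 := he (Sum.inl 3)
  have e4 := he (Sum.inl 4)
  rw [realDegree_starCliqueGraph_zero, nbrSum_starCliqueGraph_zero, h5] at e0
  rw [realDegree_starCliqueGraph_one, nbrSum_starCliqueGraph_one] at e1
  rw [realDegree_starCliqueGraph_three, nbrSum_starCliqueGraph_three] at e3
  rw [realDegree_starCliqueGraph_four, nbrSum_starCliqueGraph_four, h7] at e4
  have l2 := flow_le _ h0 h1 hd1 (Sum.inl 2 : Vertex k)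
  have n2 := flow_nonneg _ h0 h1 hd (Sum.inl 2 : Vertex k)
  have hM1 : 1 ≤ 1 / (1 - α) := by
    rw [le_div_iff₀ (by linarith)]; linarith
  simp only [← hx] at e0 e1 e3 e4 l2 n2
  refine ⟨e0, ?_, e3, e4⟩
  rw [e1]
  set M := 1 / (1 - α)
  have : α * (x 2 + groupSum (flow α (starCliqueGraph k)) 1) ≤ 1 * (M + 3 * M ^ 2) := by
    have : 0 ≤ x 2 + groupSum (flow α (starCliqueGraph k)) 1 :=
      add_nonneg n2 (Finset.sum_nonneg fun i _ => flow_nonneg _ h0 h1 hd _)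
    gcongr
  nlinarith

/-- The facts about the flow in `G'` on which the comparison with `G_k` rests; `y i` is the flow of
vertex `i`. -/
theorem flow_joinedGraph (h0 : 0 ≤ α) (h1 : α < 1) (y : Fin 5 → ℝ)
    (hy : ∀ i, y i = flow α (joinedGraph k) (Sum.inl i)) :
    (k + 2) * y 0 = 1 + α * (y 3 + y 1 + k * (1 + α * y 0)) ∧
    (k + 2) * y 1 ≤ 6 * (1 / (1 - α)) ^ 2 ∧
    (k + 2) * y 2 ≤ 6 * (1 / (1 - α)) ^ 2 ∧
    3 * y 3 = 1 + α * (y 0 + y 2 + y 4) ∧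
    (k + 1) * y 4 = 1 + α * (y 3 + k * (1 + α * y 4)) := by
  have hd1 := one_le_realDegree_joinedGraph (k := k)
  have hd : ∀ v, 0 < realDegree (joinedGraph k) v := fun v => one_pos.trans_le (hd1 v)
  have he := degree_mul_flow (joinedGraph k) h0 h1 hd
  have h5 := groupSum_flow_of_leaves h0 h1 hd 0 (Sum.inl 0) fun f i => by
    simp [nbrSum_joinedGraph, nbrSum_starCliqueGraph_five]
  have h7 := groupSum_flow_of_leaves h0 h1 hd 2 (Sum.inl 4) fun f i => by
    simp [nbrSum_joinedGraph, nbrSum_starCliqueGraph_seven]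
  have h6 := groupSum_flow_clique_le h0 h1 hd1 fun f i => by
    simp [nbrSum_joinedGraph, nbrSum_starCliqueGraph_six]
  have e0 := he (Sum.inl 0)
  have e1 := he (Sum.inl 1)
  have e2 := he (Sum.inl 2)
  have e3 := he (Sum.inl 3)
  have e4 := he (Sum.inl 4)
  rw [realDegree_joinedGraph, nbrSum_joinedGraph, realDegree_starCliqueGraph_zero,
    nbrSum_starCliqueGraph_zero, h5] at e0
  rw [realDegree_joinedGraph, nbrSum_joinedGraph, realDegree_starCliqueGraph_one,
    nbrSum_starCliqueGraph_one] at e1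
  rw [realDegree_joinedGraph, nbrSum_joinedGraph, realDegree_starCliqueGraph_two,
    nbrSum_starCliqueGraph_two] at e2
  rw [realDegree_joinedGraph, nbrSum_joinedGraph, realDegree_starCliqueGraph_three,
    nbrSum_starCliqueGraph_three] at e3
  rw [realDegree_joinedGraph, nbrSum_joinedGraph, realDegree_starCliqueGraph_four,
    nbrSum_starCliqueGraph_four, h7] at e4
  have l := fun i => flow_le _ h0 h1 hd1 (Sum.inl i : Vertex k)
  have n := fun i => flow_nonneg _ h0 h1 hd (Sum.inl i : Vertex k)
  have hM1 : 1 ≤ 1 / (1 - α) := by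
    rw [le_div_iff₀ (by linarith)]; linarith
  have hS : 0 ≤ groupSum (flow α (joinedGraph k)) 1 :=
    Finset.sum_nonneg fun i _ => flow_nonneg _ h0 h1 hd _
  simp only [← hy, Sum.inl.injEq, Fin.reduceEq, if_true, if_false, add_zero, zero_add]
    at e0 e1 e2 e3 e4 l n
  set M := 1 / (1 - α)
  set S := groupSum (flow α (joinedGraph k)) 1
  have key : ∀ i j, α * (y i + y j + S) ≤ 1 * (M + M + 3 * M ^ 2) := by
    intro i j
    have := add_nonneg (add_nonneg (n i) (n j)) hS
    have := l i
    have := l j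
    gcongr
  refine ⟨by linarith, ?_, ?_, e3, e4⟩
  · nlinarith [key 2 0]
  · nlinarith [key 1 3]

end Equations

/-! ### Comparing the two graphs -/

section Comparison

variable {k α M : ℝ}

/-- The star around `0` gives `0` a score that grows linearly. -/
theorem star_score_lower_bound {r t s : ℝ} (hα : 0 < α) (hk : 0 ≤ k) (ht : 0 ≤ t) (hs : 0 ≤ s)
    (h : r = 1 + α * (s + k * (1 + α * t))) : 1 + α * k ≤ r := by
  have : 0 ≤ α * s + α * (k * (α * t)) := by positivity
  linarith

/-- The coefficient of the flow of a star's center, once the leaves are eliminated, is positive. -/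
theorem damping_pos (hα : 0 < α) (hα1 : α < 1) (hk : 0 ≤ k) : 0 < k + 1 - α ^ 2 * k := by
  have : α ^ 2 * k ≤ 1 * k := mul_le_mul_of_nonneg_right (by nlinarith) hk
  linarith

theorem one_le_of_large (hα : 0 < α) (hα1 : α < 1) (hk : 54 * M ^ 2 < α ^ 2 * k) (hM : 1 ≤ M) :
    1 ≤ k := by
  have hα2 : α ^ 2 < 1 := by nlinarith
  nlinarith

/-- In `G'` the vertex `0` has a smaller score than `4`. -/
theorem rank_drop (hα : 0 < α) (hα1 : α < 1) (hk : 54 * M ^ 2 < α ^ 2 * k) (hM : 1 ≤ M)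
    {y0 y1 y3 y4 : ℝ} (hy0 : 1 + α * k ≤ (k + 2) * y0)
    (e0 : (k + 2) * y0 = 1 + α * (y3 + y1 + k * (1 + α * y0)))
    (e1 : (k + 2) * y1 ≤ 6 * M ^ 2)
    (e4 : (k + 1) * y4 = 1 + α * (y3 + k * (1 + α * y4))) :
    (k + 2) * y0 < (k + 1) * y4 := by
  have hk1 := one_le_of_large hα hα1 hk hM
  have hpos := damping_pos hα hα1 (by linarith : 0 ≤ k)
  -- the difference of the two equations, multiplied by `k + 1`
  have hdiff : ((k + 1) * y4 - (k + 2) * y0) * (k + 1 - α ^ 2 * k) =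
      α * (α * k * y0 - (k + 1) * y1) := by
    linear_combination (k + 1) * e4 - (k + 1) * e0
  have hgain : (k + 1) * y1 < α * k * y0 := by
    have h1 : 0 < k + 2 := by linarith
    have h2 : (k + 1) * ((k + 2) * y1) ≤ (k + 1) * (6 * M ^ 2) := by gcongr
    have h3 : α * k * (1 + α * k) ≤ α * k * ((k + 2) * y0) := by gcongr
    have h4 : (k + 1) * (6 * M ^ 2) ≤ k * (12 * M ^ 2) := by
      linarith [mul_le_mul_of_nonneg_right hk1 (sq_nonneg M)]
    have h5 : k * (12 * M ^ 2) < k * (α * (1 + α * k)) :=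
      mul_lt_mul_of_pos_left (by linarith [sq_nonneg M]) (by linarith)
    refine lt_of_mul_lt_mul_left ?_ h1.le
    linarith
  have : 0 < ((k + 1) * y4 - (k + 2) * y0) * (k + 1 - α ^ 2 * k) := by
    rw [hdiff]; exact mul_pos hα (by linarith)
  linarith [pos_of_mul_pos_left this hpos.le]

/-- The score of `0` decreases from `G_k` to `G'`. The change, multiplied by
`(k + 1 - α ^ 2 * k) / α`, consists of a loss of at least `α ^ 2 / 6` and a gain of at most
`9 * M ^ 2 / k`; this is where the bound `54 * M ^ 2 / α ^ 2` for `k` comes from. -/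
theorem score_decrease (hα : 0 < α) (hα1 : α < 1) (hk : 54 * M ^ 2 < α ^ 2 * k) (hM : 1 ≤ M)
    (hMα : M * (1 - α) = 1) {x0 x2 x3 x4 y0 y1 y2 y3 y4 : ℝ}
    (hx2 : 0 ≤ x2) (hx3 : 0 ≤ x3) (hy3 : y3 ≤ M) (hy1M : y1 ≤ M)
    (hy0 : 1 + α * k ≤ (k + 2) * y0)
    (a0 : (k + 1) * x0 = 1 + α * (x3 + k * (1 + α * x0)))
    (a3 : 3 * x3 = 1 + α * (x0 + x2 + x4))
    (a4 : (k + 1) * x4 = 1 + α * (x3 + k * (1 + α * x4)))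
    (b0 : (k + 2) * y0 = 1 + α * (y3 + y1 + k * (1 + α * y0)))
    (b1 : (k + 2) * y1 ≤ 6 * M ^ 2) (b2 : (k + 2) * y2 ≤ 6 * M ^ 2)
    (b3 : 3 * y3 = 1 + α * (y0 + y2 + y4))
    (b4 : (k + 1) * y4 = 1 + α * (y3 + k * (1 + α * y4))) :
    (k + 2) * y0 < (k + 1) * x0 := by
  have hk1 := one_le_of_large hα hα1 hk hM
  have hk0 : 0 < k := by linarith
  have hpos := damping_pos hα hα1 hk0.le
  have hy0pos : 0 < y0 :=
    pos_of_mul_pos_right (lt_of_lt_of_le (by positivity) hy0) (by linarith)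
  -- the loss is at least a constant, as `y0 ≥ α / 3`
  have hloss : α ≤ 3 * y0 := by
    refine le_of_mul_le_mul_left ?_ hk0
    linarith [mul_le_mul_of_nonneg_right hk1 hy0pos.le]
  -- a bound for the product of `d` with `k + 1 - α² k` is, up to a factor `M`, one for `k * d`
  have hdamp : ∀ d C : ℝ, 0 ≤ C → d * (k + 1 - α ^ 2 * k) ≤ C → k * d ≤ C * M := by
    intro d C hC hd
    rcases le_or_gt d 0 with h | h
    · exact (mul_nonpos_of_nonneg_of_nonpos hk0.le h).trans (by positivity)
    · have hα2 : α ^ 2 ≤ α := by nlinarith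
      have h1 : k * (1 - α) ≤ k + 1 - α ^ 2 * k := by
        linarith [mul_le_mul_of_nonneg_right hα2 hk0.le]
      have h2 : d * (k * (1 - α)) ≤ C := (mul_le_mul_of_nonneg_left h1 h.le).trans hd
      calc k * d = d * (k * (M * (1 - α))) := by rw [hMα]; ring
        _ = d * (k * (1 - α)) * M := by ring
        _ ≤ C * M := by gcongr
  have hscale : ∀ d C : ℝ, 0 ≤ C → d ≤ C → α * d ≤ C := fun d C hC hd =>
    (mul_le_mul_of_nonneg_left hd hα.le).trans (mul_le_of_le_one_left hC hα1.le)
  have h0 : k * (y0 - x0) ≤ 2 * M * M := by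
    refine hdamp _ _ (by linarith) ?_
    calc (y0 - x0) * (k + 1 - α ^ 2 * k) = α * (y3 - x3 + y1) - y0 := by
          linear_combination b0 - a0
      _ ≤ 2 * M := by linarith [hscale (y3 - x3 + y1) (2 * M) (by linarith) (by linarith)]
  have h4 : k * (y4 - x4) ≤ M * M := by
    refine hdamp _ _ (by linarith) ?_
    calc (y4 - x4) * (k + 1 - α ^ 2 * k) = α * (y3 - x3) := by linear_combination b4 - a4
      _ ≤ M := hscale _ _ (by linarith) (by linarith)
  have hsmall : ∀ y : ℝ, (k + 2) * y ≤ 6 * M ^ 2 → k * y ≤ 6 * M ^ 2 := by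
    intro y hy
    rcases le_or_gt y 0 with h | h
    · exact (mul_nonpos_of_nonneg_of_nonpos hk0.le h).trans (by positivity)
    · linarith
  -- the gain of `0` from its neighbors `3` and `1` is of order `1 / k`
  have h3 : k * (y3 - x3) ≤ 3 * M ^ 2 := by
    have e : 3 * (k * (y3 - x3)) = α * (k * (y0 - x0) + k * (y4 - x4) + (k * y2 - k * x2)) := by
      linear_combination k * b3 - k * a3
    have hb : k * (y0 - x0) + k * (y4 - x4) + (k * y2 - k * x2) ≤ 9 * M ^ 2 := by
      linarith [hsmall y2 b2, mul_nonneg hk0.le hx2]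
    linarith [hscale _ _ (by positivity) hb]
  have hgain : k * (y3 - x3 + y1) ≤ 9 * M ^ 2 := by linarith [hsmall y1 b1]
  -- loss and gain are the two terms of the difference of `a0` and `b0`, multiplied by `k + 1`
  have hdiff : ((k + 1) * x0 - (k + 2) * y0) * (k + 1 - α ^ 2 * k) =
      α * (α * k * y0 - (k + 1) * (y3 - x3 + y1)) := by
    linear_combination (k + 1) * a0 - (k + 1) * b0
  have hlt : (k + 1) * (y3 - x3 + y1) < α * k * y0 := by
    refine lt_of_mul_lt_mul_left ?_ hk0.le
    calc k * ((k + 1) * (y3 - x3 + y1)) = (k + 1) * (k * (y3 - x3 + y1)) := by ring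
      _ ≤ (k + 1) * (9 * M ^ 2) := by gcongr
      _ ≤ k * (18 * M ^ 2) := by linarith [mul_le_mul_of_nonneg_right hk1 (sq_nonneg M)]
      _ < k * (α ^ 2 * k / 3) := mul_lt_mul_of_pos_left (by linarith) hk0
      _ ≤ k * (α * k * y0) := by
        refine mul_le_mul_of_nonneg_left ?_ hk0.le
        linarith [mul_le_mul_of_nonneg_left hloss (mul_pos hα hk0).le]
  have : 0 < ((k + 1) * x0 - (k + 2) * y0) * (k + 1 - α ^ 2 * k) := by
    rw [hdiff]; exact mul_pos hα (by linarith)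
  linarith [pos_of_mul_pos_left this hpos.le]

end Comparison

end CentralityMonotonicity

open CentralityMonotonicity in
theorem mainTheorem8 (α : ℝ) (hα0 : 0 < α) (hα1 : α < 1) :
    ∃ K : ℕ, ∀ k : ℕ, K ≤ k →
      ¬ IsScoreMonotoneOn (pageRank α) (starCliqueGraph k) ∧
      ¬ IsRankMonotoneOn (pageRank α) (starCliqueGraph k) ∧
      IsTopScoreViolation (pageRank α) (starCliqueGraph k) (Sum.inl 0) (Sum.inl 1) ∧
      IsTopRankViolation (pageRank α) (starCliqueGraph k) (Sum.inl 0) (Sum.inl 1) := by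
  have hMα : 1 / (1 - α) * (1 - α) = 1 := div_mul_cancel₀ _ (by linarith)
  have hM1 : 1 ≤ 1 / (1 - α) := by
    rw [le_div_iff₀ (by linarith)]; linarith
  obtain ⟨K, hK⟩ := exists_nat_gt (54 * (1 / (1 - α)) ^ 2 / α ^ 2)
  refine ⟨K, fun k hKk => ?_⟩
  have hk : 54 * (1 / (1 - α)) ^ 2 < α ^ 2 * k := by
    have : 54 * (1 / (1 - α)) ^ 2 / α ^ 2 < k := hK.trans_le (by exact_mod_cast hKk)
    rwa [div_lt_iff₀' (by positivity)] at this
  have hk0 : (0 : ℝ) ≤ k := k.cast_nonneg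
  have hdG1 := one_le_realDegree_starCliqueGraph (k := k)
  have hdH1 := one_le_realDegree_joinedGraph (k := k)
  have hdG : ∀ v, 0 < realDegree (starCliqueGraph k) v := fun v => one_pos.trans_le (hdG1 v)
  have hdH : ∀ v, 0 < realDegree (joinedGraph k) v := fun v => one_pos.trans_le (hdH1 v)
  obtain ⟨a0, a1, a3, a4⟩ := flow_starCliqueGraph (k := k) hα0.le hα1 _ fun _ => rfl
  obtain ⟨b0, b1, b2, b3, b4⟩ := flow_joinedGraph (k := k) hα0.le hα1 _ fun _ => rfl
  have nx := fun i => flow_nonneg _ hα0.le hα1 hdG (Sum.inl i : Vertex k)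
  have ny := fun i => flow_nonneg _ hα0.le hα1 hdH (Sum.inl i : Vertex k)
  have ly := fun i => flow_le _ hα0.le hα1 hdH1 (Sum.inl i : Vertex k)
  have hx0 := star_score_lower_bound hα0 hk0 (nx 0) (nx 3) a0
  have hy0 := star_score_lower_bound hα0 hk0 (ny 0) (add_nonneg (ny 3) (ny 1)) b0
  have hdeg0 : realDegree (joinedGraph k) (Sum.inl 0) = k + 2 := by
    rw [realDegree_joinedGraph, realDegree_starCliqueGraph_zero]
    norm_num; ring
  have hdeg4 : realDegree (joinedGraph k) (Sum.inl 4) = k + 1 := by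
    rw [realDegree_joinedGraph, realDegree_starCliqueGraph_four]
    simp
  have htop : pageRank α (starCliqueGraph k) (Sum.inl 1) <
      pageRank α (starCliqueGraph k) (Sum.inl 0) := by
    rw [pageRank_lt_iff hα1 hdG hdG, realDegree_starCliqueGraph_zero,
      realDegree_starCliqueGraph_one]
    have : α ^ 2 * k ≤ α * k := mul_le_mul_of_nonneg_right (by nlinarith) hk0
    linarith [sq_nonneg (1 / (1 - α))]
  -- the vertex `4` is a twin of `0` in `G_k`
  have htwin : pageRank α (starCliqueGraph k) (Sum.inl 4) ≤
      pageRank α (starCliqueGraph k) (Sum.inl 0) := by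
    rw [← not_lt, pageRank_lt_iff hα1 hdG hdG, realDegree_starCliqueGraph_zero,
      realDegree_starCliqueGraph_four, not_lt]
    have hpos := damping_pos hα0 hα1 hk0
    have : flow α (starCliqueGraph k) (Sum.inl 4) = flow α (starCliqueGraph k) (Sum.inl 0) := by
      refine mul_right_cancel₀ hpos.ne' ?_
      linear_combination a4 - a0
    rw [this]
  have hscore : IsTopScoreViolation (pageRank α) (starCliqueGraph k) (Sum.inl 0) (Sum.inl 1) := by
    refine ⟨by simp, starCliqueGraph_not_adj, htop, ?_⟩
    rw [pageRank_lt_iff hα1 hdH hdG, realDegree_starCliqueGraph_zero, hdeg0]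
    exact score_decrease hα0 hα1 hk hM1 hMα (nx 2) (nx 3) (ly 3) (ly 1) hy0
      a0 a3 a4 b0 b1 b2 b3 b4
  have hrank : IsTopRankViolation (pageRank α) (starCliqueGraph k) (Sum.inl 0) (Sum.inl 1) := by
    refine ⟨by simp, starCliqueGraph_not_adj, htop, Sum.inl 4, by simp, by simp,
      Or.inr ⟨htwin, ?_⟩⟩
    rw [pageRank_lt_iff hα1 hdH hdH, hdeg0, hdeg4]
    exact rank_drop hα0 hα1 hk hM1 hy0 b0 b1 b4
  exact ⟨hscore.not_isScoreMonotoneOn, hrank.not_isRankMonotoneOn, hscore, hrank⟩
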